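/- For a group $G$ with neutral element $e$, a $G$-automaton over a finite alphabet $\Sigma$ is a nondeterministic finite automaton with a finite set $Q$ of states, an initial state, a set of accepting states, and a register that holds an element of $G$ and initially holds $e$. Its moves are given by finite sets $\delta(q,\sigma)\subseteq Q\times G$ for $q\in Q$, $\sigma\in\Sigma\cup\{\varepsilon\}$: if $(q',m)\in\delta(q,\sigma)$, the automaton in state $q$ can, in one step, read $\sigma$ (nothing if $\sigma=\varepsilon$), pass to state $q'$ and replace the register content $x$ by $xm$. A computation on $w\in\Sigma^*$ is successful if it ends, after reading all of $w$, in an accepting state with $e$ in the register; the automaton recognizes the language of the words that have a successful computation. It is weakly $t(n)$ time-bounded if each word of length $n$ in this language has a successful computation with at most $t(n)$ steps. Let $\mathfrak{L}(G)^w_{O(n)}$ be the class of languages, over arbitrary finite alphabets, that are recognized by a weakly $t(n)$ time-bounded $G$-automaton for some $t(n)=O(n)$. Let $\mathsf{CF}$ be the class of context-free languages, and let $\mathbf{H}$ be the discrete Heisenberg group, that is, the group of $3\times 3$ upper unitriangular integer matrices. Two classes are incomparable if neither is contained in the other. **Theorem.** i. For every $k\ge 5$, the classes $\mathfrak{L}(\mathbf{H})^w_{O(n)}$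 and $\mathfrak{L}(\mathbb{Z}^k)^w_{O(n)}$ are incomparable. Specifically, the language $\mathtt{MULT}=\{x^py^qz^{pq}\mid p,q\ge 0\}$ belongs to $\mathfrak{L}(\mathbf{H})^w_{O(n)}$ but not to $\mathfrak{L}(\mathbb{Z}^k)^w_{O(n)}$, and the language $\mathtt{L}_5=\{0^{a_1}10^{a_2}1\cdots 0^{a_5}1\,0^{a_1}10^{a_2}1\cdots 0^{a_5}1\mid a_1,\dots,a_5\ge 0\}$ belongs to $\mathfrak{L}(\mathbb{Z}^k)^w_{O(n)}$ but not to $\mathfrak{L}(\mathbf{H})^w_{O(n)}$. ii. The classes $\mathfrak{L}(\mathbf{H})^w_{O(n)}$ and $\mathsf{CF}$ are incomparable. -/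

import Mathlib

open Filter Asymptotics

/-- A finite automaton over the group `G` (extended finite automaton) with input alphabet `α`:
`(q', m) ∈ δ q (some a)` means that in state `q` it can read `a`, move to `q'` and multiply the
register by `m` on the right; `(q', m) ∈ δ q none` is such a move that reads nothing.
States are finite in number and so are the moves. -/
structure GroupAutomaton (G : Type*) (α : Type*) where
  State : Type
  finite_state : Finite State
  δ : State → Option α → Set (State × G)
  finite_δ : ∀ q a, (δ q a).Finite
  start : State
  accept : Set State

namespace GroupAutomaton

variable {G : Type*} [Group G] {α : Type*}

/-- A configuration: current state, content of the register, unread part of the input. -/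
abbrev Config (A : GroupAutomaton G α) : Type _ := A.State × G × List α

/-- One step of a computation. -/
inductive Step (A : GroupAutomaton G α) : A.Config → A.Config → Prop
  | read {q q' : A.State} {x m : G} {a : α} {w : List α} (h : (q', m) ∈ A.δ q (some a)) :
      Step A (q, x, a :: w) (q', x * m, w)
  | eps {q q' : A.State} {x m : G} {w : List α} (h : (q', m) ∈ A.δ q none) :
      Step A (q, x, w) (q', x * m, w)

/-- `A.ReachesIn n c c'`: some computation of exactly `n` steps leads from `c` to `c'`. -/
inductive ReachesIn (A : GroupAutomaton G α) : ℕ → A.Config → A.Config → Prop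
  | refl (c : A.Config) : ReachesIn A 0 c c
  | tail {n : ℕ} {c d e : A.Config} (h : ReachesIn A n c d) (hs : A.Step d e) :
      ReachesIn A (n + 1) c e

/-- `A` has a successful computation of exactly `n` steps on `w`: it starts in the initial state
with the neutral element in the register, and ends, with all of `w` read, in an accepting state
with the neutral element in the register. -/
def AcceptsIn (A : GroupAutomaton G α) (w : List α) (n : ℕ) : Prop :=
  ∃ q ∈ A.accept, A.ReachesIn n (A.start, 1, w) (q, 1, [])

/-- The language recognized by `A`. -/
def language (A : GroupAutomaton G α) : Language α :=
  {w | ∃ n, A.AcceptsIn w n}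

/-- `A` is weakly `t(n)` time-bounded: every accepted string of length `n` has a successful
computation of at most `t n` steps. -/
def WeaklyTimeBounded (A : GroupAutomaton G α) (t : ℕ → ℕ) : Prop :=
  ∀ w ∈ A.language, ∃ s ≤ t w.length, A.AcceptsIn w s

end GroupAutomaton

/-- A class of languages: for each finite alphabet, a set of languages over it. -/
abbrev LanguageClass : Type 1 := ∀ (α : Type) [Finite α], Set (Language α)

namespace LanguageClass

/-- Inclusion of classes of languages. -/
def Included (C D : LanguageClass) : Prop :=
  ∀ (α : Type) [Finite α], C α ⊆ D α

/-- Neither class of languages is included in the other. -/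
def Incomparable (C D : LanguageClass) : Prop :=
  ¬ Included C D ∧ ¬ Included D C

/-- The class of languages recognized by weakly `t(n)` time-bounded `G`-automata. -/
def weakTime (G : Type*) [Group G] (t : ℕ → ℕ) : LanguageClass := fun α _ =>
  {L | ∃ A : GroupAutomaton G α, A.language = L ∧ A.WeaklyTimeBounded t}

/-- The class of languages recognized by weakly `O(n)` time-bounded `G`-automata. -/
def weakLinearTime (G : Type*) [Group G] : LanguageClass := fun α _ =>
  {L | ∃ t : ℕ → ℕ, (fun n => (t n : ℝ)) =O[atTop] (fun n => (n : ℝ)) ∧ L ∈ weakTime G t α}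

/-- The class of context-free languages. -/
def contextFree : LanguageClass := fun _ _ => {L | L.IsContextFree}

end LanguageClass

/-- The discrete Heisenberg group: the `3 × 3` upper unitriangular integer matrices. -/
def heisenbergGroup : Subgroup (Matrix.SpecialLinearGroup (Fin 3) ℤ) where
  carrier := {g | (∀ i, g.1 i i = 1) ∧ ∀ i j, j < i → g.1 i j = 0}
  one_mem' := by
    refine ⟨fun i => by simp, fun i j h => ?_⟩
    simp [Matrix.one_apply_ne h.ne']
  mul_mem' := by
    rintro a b ⟨ha, ha'⟩ ⟨hb, hb'⟩
    have a1 := ha' 1 0 (by decide)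
    have a2 := ha' 2 0 (by decide)
    have a3 := ha' 2 1 (by decide)
    have b1 := hb' 1 0 (by decide)
    have b2 := hb' 2 0 (by decide)
    have b3 := hb' 2 1 (by decide)
    refine ⟨fun i => ?_, fun i j h => ?_⟩
    · fin_cases i <;> simp_all [Matrix.mul_apply, Fin.sum_univ_three]
    · fin_cases i <;> fin_cases j <;>
        first
          | exact absurd h (by decide)
          | simp_all [Matrix.mul_apply, Fin.sum_univ_three]
  inv_mem' := by
    rintro a ⟨ha, ha'⟩
    have a1 := ha' 1 0 (by decide)
    have a2 := ha' 2 0 (by decide)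
    have a3 := ha' 2 1 (by decide)
    refine ⟨fun i => ?_, fun i j h => ?_⟩
    · fin_cases i <;>
        simp_all [Matrix.SpecialLinearGroup.coe_inv, Matrix.adjugate_fin_three]
    · fin_cases i <;> fin_cases j <;>
        first
          | exact absurd h (by decide)
          | simp_all [Matrix.SpecialLinearGroup.coe_inv, Matrix.adjugate_fin_three]

/-- The language `{x^p y^q z^(pq) | p, q ≥ 0}`, with `x, y, z` written as `0, 1, 2`. -/
def multLanguage : Language (Fin 3) :=
  {w | ∃ p q : ℕ, w = List.replicate p 0 ++ List.replicate q 1 ++ List.replicate (p * q) 2}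

/-- The word `0^(a₁) 1 0^(a₂) 1 … 0^(aₖ) 1`. -/
def unaryBlocks {k : ℕ} (a : Fin k → ℕ) : List (Fin 2) :=
  (List.ofFn fun i => List.replicate (a i) 0 ++ [1]).flatten

/-- The language `{0^(a₁) 1 … 0^(aₖ) 1 0^(a₁) 1 … 0^(aₖ) 1 | a₁, …, aₖ ≥ 0}`. -/
def repeatedBlocksLanguage (k : ℕ) : Language (Fin 2) :=
  {w | ∃ a : Fin k → ℕ, w = unaryBlocks a ++ unaryBlocks a}

/-!
Recognition by a `G`-automaton is studied through its runs, the lists of transitions that lead from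
one state to another; a run spells a word and has a weight, the product of its multipliers.

*Commutative groups.* By Higman's lemma, among infinitely many accepting runs there are two with the
same end points such that the first is a subsequence of the second. The factors of the second that
the first leaves out are then closed paths (`GroupAutomaton.IsRun.exists_perm_of_sublist`), so that
all of them can be traversed once more. In a commutative group the weight stays trivial, so for two
of any infinitely many recognized words, the arithmetic progression that their letter counts begin
has a recognized third term (`GroupAutomaton.exists_count_add_count_eq`). The counts
`(n, n, n ^ 2)` rule this out for `multLanguage`, whatever the time bound.

*The Heisenberg group.* A product of `s` elements of a fixed finite set has entries of size `O(s)`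
above the diagonal and `O(s ^ 2)` in the corner, so it takes only `O(s ^ 4)` values. A recognizer in
linear time therefore tells apart only `O(n ^ 4)` prefixes of words of length `n`
(`exists_card_fooling_le`). Both `repeatedBlocksLanguage 5` and the even palindromes over two
letters tell apart the `n ^ 5` prefixes `unaryBlocks a` with entries below `n`
(`notMem_weakLinearTime_heisenbergGroup`), and the even palindromes are context-free.

*Positive results.* `multLanguage` and `repeatedBlocksLanguage 5` are recognized by automata whose
states form a chain with a loop at each state (`GroupAutomaton.chain_acceptsIn_iff`), the first by
the identity `x ^ p * y ^ q * z ^ (-p * q) = y ^ q * x ^ p` for the generators of the Heisenberg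
group, the second by five counters.

*Context-free languages.* That `multLanguage` is not context-free follows from the pumping lemma
(`Language.IsContextFree.pumping`), which is proved with parse trees of least height: two subtrees
with the same root on one path have different least heights, so they stand for different words.
-/

/-! ### Runs of a group automaton as lists of transitions -/

namespace GroupAutomaton

variable {G : Type*} {α : Type*}

/-- A potential move of `A`: source state, label (`none` for a move that reads nothing), target
state, and the group element by which the register is multiplied. -/
structure Transition (A : GroupAutomaton G α) where
  src : A.State
  label : Option α
  tgt : A.State
  weight : G

/-- The moves that `A` really has. -/
def transitions (A : GroupAutomaton G α) : Set A.Transition :=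
  {t | (t.tgt, t.weight) ∈ A.δ t.src t.label}

/-- `A.IsRun q r q'`: the transitions in `r` are moves of `A` that lead, one after the other, from
state `q` to state `q'`. -/
def IsRun (A : GroupAutomaton G α) : A.State → List A.Transition → A.State → Prop
  | q, [], q' => q = q'
  | q, t :: r, q' => t.src = q ∧ t ∈ A.transitions ∧ IsRun A t.tgt r q'

/-- The word read along a list of transitions. -/
def word {A : GroupAutomaton G α} (r : List A.Transition) : List α :=
  r.filterMap Transition.label

variable {A : GroupAutomaton G α}

@[simp] lemma word_nil : word ([] : List A.Transition) = [] := rfl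

@[simp] lemma word_append (r s : List A.Transition) : word (r ++ s) = word r ++ word s := by
  simp [word]

lemma isRun_append {r s : List A.Transition} {q q' : A.State} :
    A.IsRun q (r ++ s) q' ↔ ∃ p, A.IsRun q r p ∧ A.IsRun p s q' := by
  induction r generalizing q with
  | nil => simp [IsRun]
  | cons t r ih => simp [IsRun, ih, and_assoc]

lemma IsRun.mem_transitions {r : List A.Transition} {q q' : A.State} (h : A.IsRun q r q') :
    ∀ t ∈ r, t ∈ A.transitions := by
  induction r generalizing q with
  | nil => simp
  | cons t r ih =>
    rintro u (_ | ⟨_, hu⟩)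
    · exact h.2.1
    · exact ih h.2.2 u hu

lemma finite_transitions [Finite α] (A : GroupAutomaton G α) : A.transitions.Finite := by
  have := A.finite_state
  have h : (⋃ q, ⋃ a,
      (fun p : A.State × G => Transition.mk (A := A) q a p.1 p.2) '' A.δ q a).Finite :=
    Set.finite_iUnion fun q => Set.finite_iUnion fun a => (A.finite_δ q a).image _
  refine h.subset ?_
  rintro ⟨q, a, q', m⟩ ht
  simp only [Set.mem_iUnion]
  exact ⟨q, a, (q', m), ht, rfl⟩

/-- If a run `r` is a subsequence of a run `s` with the same end points, then the factors of `s`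
left out by `r` are closed paths, so each of them can be traversed once more. -/
lemma IsRun.exists_perm_of_sublist {q q' : A.State} {r s : List A.Transition}
    (hr : A.IsRun q r q') (hs : A.IsRun q s q') (h : r.Sublist s) :
    ∃ p, A.IsRun q p q' ∧ (p ++ r).Perm (s ++ s) := by
  induction r generalizing q s with
  | nil =>
    obtain rfl : q = q' := hr
    exact ⟨s ++ s, isRun_append.2 ⟨_, hs, hs⟩, by simp⟩
  | cons t r ih =>
    obtain ⟨s₁, s₂, rfl, ht, hsub⟩ := List.cons_sublist_iff.1 h
    obtain ⟨u, v, rfl⟩ := List.append_of_mem ht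
    rw [List.append_assoc, List.cons_append] at hs
    obtain ⟨p, hu, hp, htm, hv⟩ := isRun_append.1 hs
    obtain ⟨rfl, -, hr⟩ := hr
    obtain rfl : t.src = p := hp
    obtain ⟨z, hz, hperm⟩ := ih hr hv (hsub.trans (List.sublist_append_right _ _))
    refine ⟨u ++ (u ++ t :: z), isRun_append.2 ⟨_, hu, isRun_append.2 ⟨_, hu, rfl, htm, hz⟩⟩, ?_⟩
    classical
    rw [List.perm_iff_count] at hperm ⊢
    intro x
    have := hperm x
    simp only [List.count_append, List.count_cons] at this ⊢
    omega

variable [Group G]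

/-- The product of the register multipliers along a list of transitions. -/
def weight (r : List A.Transition) : G :=
  (r.map Transition.weight).prod

@[simp] lemma weight_nil : weight ([] : List A.Transition) = 1 := rfl

@[simp] lemma weight_cons (t : A.Transition) (r : List A.Transition) :
    weight (t :: r) = t.weight * weight r := by
  simp [weight]

@[simp] lemma weight_append (r s : List A.Transition) : weight (r ++ s) = weight r * weight s := by
  simp [weight]

lemma ReachesIn.head {n : ℕ} {c d e : A.Config} (hs : A.Step c d) (h : A.ReachesIn n d e) :
    A.ReachesIn (n + 1) c e := by
  induction h with
  | refl => exact .tail (.refl _) hs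
  | tail _ hs' ih => exact .tail (ih hs) hs'

lemma IsRun.reachesIn {r : List A.Transition} {q q' : A.State} (h : A.IsRun q r q') (x : G)
    (v : List α) : A.ReachesIn r.length (q, x, word r ++ v) (q', x * weight r, v) := by
  induction r generalizing q x with
  | nil =>
    obtain rfl : q = q' := h
    simpa using ReachesIn.refl (A := A) (q, x, v)
  | cons t r ih =>
    obtain ⟨rfl, ht, hr⟩ := h
    have h1 := ih hr (x * t.weight)
    rw [weight_cons, ← mul_assoc]
    refine ReachesIn.head ?_ h1
    obtain ⟨p, l, p', m⟩ := t
    cases l with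
    | none => exact Step.eps ht
    | some a => exact Step.read ht

lemma ReachesIn.exists_isRun {n : ℕ} {c d : A.Config} (h : A.ReachesIn n c d) :
    ∃ r : List A.Transition, A.IsRun c.1 r d.1 ∧ r.length = n ∧ c.2.2 = word r ++ d.2.2 ∧
      d.2.1 = c.2.1 * weight r := by
  induction h with
  | refl => exact ⟨[], rfl, rfl, by simp⟩
  | @tail n c d e _ hs ih =>
    obtain ⟨r, h1, h2, h3, h4⟩ := ih
    obtain ⟨t, ht1, ht2, ht3⟩ : ∃ t : A.Transition, A.IsRun d.1 [t] e.1 ∧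
        d.2.2 = word [t] ++ e.2.2 ∧ e.2.1 = d.2.1 * t.weight := by
      cases hs with
      | @read q q' x m a w h => exact ⟨⟨q, some a, q', m⟩, ⟨rfl, h, rfl⟩, rfl, rfl⟩
      | @eps q q' x m w h => exact ⟨⟨q, none, q', m⟩, ⟨rfl, h, rfl⟩, rfl, rfl⟩
    refine ⟨r ++ [t], isRun_append.2 ⟨_, h1, ht1⟩, by simp [h2], ?_, ?_⟩
    · rw [h3, ht2, word_append, List.append_assoc]
    · simp [ht3, h4, mul_assoc]

lemma acceptsIn_iff {w : List α} {n : ℕ} :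
    A.AcceptsIn w n ↔ ∃ q ∈ A.accept, ∃ r, A.IsRun A.start r q ∧ r.length = n ∧ word r = w ∧
      weight r = 1 := by
  constructor
  · rintro ⟨q, hq, h⟩
    obtain ⟨r, h1, h2, h3, h4⟩ := h.exists_isRun
    exact ⟨q, hq, r, h1, h2, by simpa using h3.symm, by simpa using h4.symm⟩
  · rintro ⟨q, hq, r, h1, rfl, rfl, h4⟩
    refine ⟨q, hq, ?_⟩
    simpa [h4] using h1.reachesIn 1 []

lemma mem_language_iff {w : List α} :
    w ∈ A.language ↔ ∃ q ∈ A.accept, ∃ r, A.IsRun A.start r q ∧ word r = w ∧ weight r = 1 := by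
  change (∃ n, A.AcceptsIn w n) ↔ _
  simp only [acceptsIn_iff]
  grind

/-! ### Pumping for automata over commutative groups -/

/-- Among infinitely many words recognized by an automaton over a commutative group, there are two,
`u m` and `u n` with `m < n`, whose letter counts extend by one more step of the arithmetic
progression they start: by Higman's lemma some accepting run is a subsequence of a later one. -/
theorem exists_count_add_count_eq {G : Type*} [CommGroup G] [Finite α] [DecidableEq α]
    (A : GroupAutomaton G α) (u : ℕ → List α) (hu : ∀ n, u n ∈ A.language) :
    ∃ m n, m < n ∧ ∃ w ∈ A.language, ∀ a, w.count a + (u m).count a = 2 * (u n).count a := by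
  simp only [mem_language_iff] at hu
  choose q hq r hr hru hr1 using hu
  have hwqo := Set.PartiallyWellOrderedOn.partiallyWellOrderedOn_sublistForall₂
    (Eq (α := A.Transition)) A.finite_transitions.partiallyWellOrderedOn
  have : IsPreorder (List A.Transition) (List.SublistForall₂ Eq) := {}
  obtain ⟨g, hg⟩ := hwqo.exists_monotone_subseq (f := r) fun n => (hr n).mem_transitions
  have := A.finite_state
  -- Among the indices of a subsequence monotone for embedding, two have the same final state.
  obtain ⟨i, j, hij, hqij⟩ : ∃ i j, i < j ∧ q (g i) = q (g j) := by
    obtain ⟨i, j, hij, h⟩ := Finite.exists_ne_map_eq_of_infinite (q ∘ g)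
    rcases hij.lt_or_gt with h' | h'
    · exact ⟨i, j, h', h⟩
    · exact ⟨j, i, h', h.symm⟩
  have hsub : (r (g i)).Sublist (r (g j)) := by
    obtain ⟨l, hl, hl'⟩ := List.sublistForall₂_iff.1 (hg i j hij.le)
    rw [List.forall₂_eq_eq_eq] at hl
    exact hl ▸ hl'
  obtain ⟨p, hp, hperm⟩ := (hqij ▸ hr (g i)).exists_perm_of_sublist (hr (g j)) hsub
  refine ⟨g i, g j, g.strictMono hij, word p, mem_language_iff.2 ⟨_, hq _, p, hp, rfl, ?_⟩, ?_⟩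
  · have h : weight p * weight (r (g i)) = weight (r (g j)) * weight (r (g j)) := by
      simpa [weight] using (hperm.map Transition.weight).prod_eq
    simpa [hr1] using h
  · intro a
    have := (hperm.filterMap Transition.label).count_eq a
    rw [List.filterMap_append, List.filterMap_append, List.count_append, List.count_append] at this
    rw [← hru, ← hru, two_mul]
    exact this

/-! ### Fooling sets -/

/-- If the words `u i ++ v i` are recognized and no `u i ++ v j` with `i ≠ j` is, then the prefixes
`u i` lead to different pairs of a state and a register content. -/
theorem card_le_of_fooling {ι : Type*} (A : GroupAutomaton G α) (I : Finset ι) (u v : ι → List α)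
    (s : ℕ) (hmem : ∀ i ∈ I, ∃ n ≤ s, A.AcceptsIn (u i ++ v i) n)
    (hne : ∀ i ∈ I, ∀ j ∈ I, u i ++ v j ∈ A.language → i = j) (B : Finset G)
    (hB : ∀ r : List A.Transition, (∀ t ∈ r, t ∈ A.transitions) → r.length ≤ s → weight r ∈ B) :
    I.card ≤ Nat.card A.State * B.card := by
  classical
  have := A.finite_state
  have := Fintype.ofFinite A.State
  have key : ∀ i ∈ I, ∃ p q r r', q ∈ A.accept ∧ A.IsRun A.start r p ∧ A.IsRun p r' q ∧
      word r = u i ∧ word r' = v i ∧ weight r * weight r' = 1 ∧ r.length ≤ s := by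
    intro i hi
    obtain ⟨n, hn, h⟩ := hmem i hi
    obtain ⟨q, hq, r, h1, rfl, h3, h4⟩ := acceptsIn_iff.1 h
    obtain ⟨r₁, r₂, rfl, h5, h6⟩ := List.filterMap_eq_append_iff.1 h3
    obtain ⟨p, h7, h8⟩ := isRun_append.1 h1
    refine ⟨p, q, r₁, r₂, hq, h7, h8, h5, h6, by simpa using h4, le_trans (by simp) hn⟩
  have : Nonempty A.State := ⟨A.start⟩
  choose! p q r r' hq hr hr' hu hv hw hl using key
  rw [Nat.card_eq_fintype_card, ← Finset.card_univ, ← Finset.card_product]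
  refine Finset.card_le_card_of_injOn (fun i => (p i, weight (r i))) ?_ ?_
  · intro i hi
    simpa using hB _ (hr i hi).mem_transitions (hl i hi)
  · intro i hi j hj hij
    obtain ⟨hp, hwt⟩ := Prod.mk.inj hij
    refine hne i hi j hj (mem_language_iff.2 ⟨q j, hq j hj, r i ++ r' j,
      isRun_append.2 ⟨p i, hr i hi, ?_⟩, ?_, ?_⟩)
    · exact hp ▸ hr' j hj
    · rw [word_append, hu i hi, hv j hj]
    · rw [weight_append, hwt, hw j hj]

end GroupAutomaton

/-! ### Automata that run through a chain of loops -/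

namespace GroupAutomaton

variable {G : Type*} [Group G] {α : Type*}

/-- The automaton with states `0, …, n`, started in `0` and accepting in `n`: each state `i < n` has
a loop with label `a i` and register multiplier `g i`, and an exit to `i + 1` with label `b i` and
multiplier `1`. Values of `a`, `b`, `g` from `n` on are irrelevant. -/
def chain (n : ℕ) (a b : ℕ → Option α) (g : ℕ → G) : GroupAutomaton G α where
  State := Fin (n + 1)
  finite_state := inferInstance
  δ q l := {t | q.val < n ∧
    (l = a q ∧ t = (q, g q) ∨ l = b q ∧ t.1.val = q.val + 1 ∧ t.2 = 1)}
  finite_δ q l := by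
    refine (Set.finite_univ.prod (Set.toFinite {g q, 1})).subset ?_
    rintro ⟨p, m⟩ ⟨-, ⟨-, h⟩ | ⟨-, -, h⟩⟩
    · simp [(Prod.mk.inj h).2]
    · exact ⟨trivial, Or.inr h⟩
  start := 0
  accept := {Fin.last n}

/-- The labels along a path from state `s` to state `s + d` of a chain automaton that takes the
loop at each state `i` exactly `c i` times. -/
def chainLabels (a b : ℕ → Option α) (c : ℕ → ℕ) (s d : ℕ) : List (Option α) :=
  (List.range' s d).flatMap fun i => List.replicate (c i) (a i) ++ [b i]

/-- The register multiplier of the path described at `chainLabels`. -/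
def chainWeight (g : ℕ → G) (c : ℕ → ℕ) (s d : ℕ) : G :=
  ((List.range' s d).map fun i => g i ^ c i).prod

lemma chainLabels_succ (a b : ℕ → Option α) (c : ℕ → ℕ) (s d : ℕ) :
    chainLabels a b c s (d + 1) =
      List.replicate (c s) (a s) ++ b s :: chainLabels a b c (s + 1) d := by
  simp [chainLabels, List.range'_succ]

lemma chainWeight_succ (g : ℕ → G) (c : ℕ → ℕ) (s d : ℕ) :
    chainWeight g c s (d + 1) = g s ^ c s * chainWeight g c (s + 1) d := by
  simp [chainWeight, List.range'_succ]

lemma chainLabels_update (a b : ℕ → Option α) (c : ℕ → ℕ) (s d x : ℕ) :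
    chainLabels a b (Function.update c s x) (s + 1) d = chainLabels a b c (s + 1) d := by
  refine List.flatMap_congr fun i hi => ?_
  rw [Function.update_of_ne]
  have := (List.mem_range'_1.1 hi).1
  omega

lemma chainWeight_update (g : ℕ → G) (c : ℕ → ℕ) (s d x : ℕ) :
    chainWeight g (Function.update c s x) (s + 1) d = chainWeight g c (s + 1) d := by
  refine congrArg List.prod (List.map_congr_left fun i hi => ?_)
  rw [Function.update_of_ne]
  have := (List.mem_range'_1.1 hi).1
  omega

variable {n : ℕ} {a b : ℕ → Option α} {g : ℕ → G}

lemma exists_isRun_chain (c : ℕ → ℕ) (d : ℕ) (q : (chain n a b g).State)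
    (hq : (q : Fin (n + 1)).val + d = n) :
    ∃ r, (chain n a b g).IsRun q r (Fin.last n) ∧
      r.map Transition.label = chainLabels a b c (q : Fin (n + 1)).val d ∧
      weight r = chainWeight g c (q : Fin (n + 1)).val d := by
  induction d generalizing q with
  | zero => exact ⟨[], Fin.ext (by simpa using hq), rfl, rfl⟩
  | succ d ih =>
    obtain ⟨i, hi⟩ := q
    change i + (d + 1) = n at hq
    obtain ⟨r, h1, h2, h3⟩ := ih (⟨i + 1, by omega⟩ : Fin (n + 1)) (by simp; omega)
    let q : (chain n a b g).State := (⟨i, hi⟩ : Fin (n + 1))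
    let q' : (chain n a b g).State := (⟨i + 1, by omega⟩ : Fin (n + 1))
    let u : (chain n a b g).Transition := ⟨q, a i, q, g i⟩
    let t : (chain n a b g).Transition := ⟨q, b i, q', 1⟩
    have hu : u ∈ (chain n a b g).transitions := ⟨show i < n by omega, Or.inl ⟨rfl, rfl⟩⟩
    have ht : t ∈ (chain n a b g).transitions :=
      ⟨show i < n by omega, Or.inr ⟨rfl, rfl, rfl⟩⟩
    have hloop : ∀ k, (chain n a b g).IsRun q (List.replicate k u) q := by
      intro k
      induction k with
      | zero => rfl
      | succ k ih => exact ⟨rfl, hu, ih⟩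
    refine ⟨List.replicate (c i) u ++ t :: r, isRun_append.2 ⟨q, hloop _, rfl, ht, h1⟩, ?_, ?_⟩
    · rw [chainLabels_succ, ← h2]
      simp [u, t]
    · rw [chainWeight_succ, ← h3]
      simp [weight, u, t]

lemma IsRun.exists_chainLabels {r : List (chain n a b g).Transition} {q : (chain n a b g).State}
    (h : (chain n a b g).IsRun q r (Fin.last n)) :
    ∃ c, r.map Transition.label =
        chainLabels a b c (q : Fin (n + 1)).val (n - (q : Fin (n + 1)).val) ∧
      weight r = chainWeight g c (q : Fin (n + 1)).val (n - (q : Fin (n + 1)).val) := by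
  induction r generalizing q with
  | nil =>
    obtain rfl : q = Fin.last n := h
    exact ⟨0, by simp [chainLabels], by simp [chainWeight]⟩
  | cons t r ih =>
    obtain ⟨⟨i, hi⟩, l, ⟨j, hj⟩, m⟩ := t
    obtain ⟨rfl, ht, hr⟩ := h
    obtain ⟨c, h1, h2⟩ := ih hr
    obtain ⟨hin : i < n, ⟨hl : l = a i, hp⟩ | ⟨hl : l = b i, hji : j = i + 1, hm : m = 1⟩⟩ := ht
    · obtain ⟨hj', hm : m = g i⟩ := Prod.mk.inj hp
      obtain rfl : j = i := congrArg Fin.val hj'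
      obtain ⟨d, hd⟩ : ∃ d, n - j = d + 1 := ⟨n - j - 1, by omega⟩
      refine ⟨Function.update c j (c j + 1), ?_, ?_⟩
      · simp only [hd, chainLabels_succ, chainLabels_update, Function.update_self] at h1 ⊢
        simp [List.replicate_succ, hl, h1]
      · simp only [hd, chainWeight_succ, chainWeight_update, Function.update_self] at h2 ⊢
        simp [pow_succ', mul_assoc, hm, h2]
    · subst hji
      obtain ⟨d, hd⟩ : ∃ d, n - i = d + 1 := ⟨n - i - 1, by omega⟩
      have hd' : n - (i + 1) = d := by omega
      refine ⟨Function.update c i 0, ?_, ?_⟩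
      · simp only [hd, hd', chainLabels_succ, chainLabels_update, Function.update_self] at h1 ⊢
        simp [hl, h1]
      · simp only [hd, hd', chainWeight_succ, chainWeight_update, Function.update_self] at h2 ⊢
        simp [hm, h2]

/-- Computations of a chain automaton amount to a choice of the number of times each loop is
taken. -/
theorem chain_acceptsIn_iff {w : List α} {m : ℕ} :
    (chain n a b g).AcceptsIn w m ↔ ∃ c, (chainLabels a b c 0 n).reduceOption = w ∧
      chainWeight g c 0 n = 1 ∧ (chainLabels a b c 0 n).length = m := by
  have hword : ∀ r : List (chain n a b g).Transition,
      word r = (r.map Transition.label).reduceOption := by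
    intro r
    simp [word, List.reduceOption, List.filterMap_map]
  rw [acceptsIn_iff]
  constructor
  · rintro ⟨q, rfl, r, h1, rfl, rfl, h4⟩
    obtain ⟨c, h5, h6⟩ := h1.exists_chainLabels
    refine ⟨c, ?_, ?_, ?_⟩
    · rw [hword, h5]; rfl
    · rw [← h4, h6]; rfl
    · rw [← List.length_map (f := Transition.label) (as := r), h5]; rfl
  · rintro ⟨c, rfl, h2, rfl⟩
    obtain ⟨r, h3, h4, h5⟩ := exists_isRun_chain (a := a) (b := b) (g := g) c n
      (0 : Fin (n + 1)) (Nat.zero_add n)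
    refine ⟨_, rfl, r, h3, ?_, ?_, ?_⟩
    · rw [← List.length_map (f := Transition.label), h4]; rfl
    · rw [hword, h4]; rfl
    · rw [h5]; exact h2

end GroupAutomaton

/-! ### The pumping lemma for context-free languages -/

namespace ContextFreeGrammar

variable {T : Type*}

/-- The words that a symbol stands for, given for each nonterminal the words it stands for. -/
def symbolYield {N : Type*} (L : N → Language T) : Symbol T N → Language T
  | .terminal a => {[a]}
  | .nonterminal B => L B

/-- The words that a string of symbols stands for, given for each nonterminal the words it stands
for. -/
def stringYield {N : Type*} (L : N → Language T) (s : List (Symbol T N)) : Language T :=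
  (s.map (symbolYield L)).prod

/-- `g.yield h A`: the words over the terminals that have a parse tree of height at most `h` with
root `A`, a single leaf having height `0`. -/
def yield (g : ContextFreeGrammar T) : ℕ → g.NT → Language T
  | 0, _ => 0
  | h + 1, A => {w | ∃ r ∈ g.rules, r.input = A ∧ w ∈ stringYield (yield g h) r.output}

section StringYield

variable {N : Type*} {L L' : N → Language T}

lemma mem_stringYield_nil {w : List T} : w ∈ stringYield L [] ↔ w = [] := by
  simp [stringYield, Language.mem_one]

lemma mem_stringYield_cons {w : List T} {x : Symbol T N} {s : List (Symbol T N)} :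
    w ∈ stringYield L (x :: s) ↔ ∃ u ∈ symbolYield L x, ∃ v ∈ stringYield L s, u ++ v = w := by
  simp [stringYield, Language.mem_mul]

lemma mem_stringYield_append {w : List T} {s t : List (Symbol T N)} :
    w ∈ stringYield L (s ++ t) ↔ ∃ u ∈ stringYield L s, ∃ v ∈ stringYield L t, u ++ v = w := by
  simp [stringYield, Language.mem_mul]

lemma mem_symbolYield_terminal {w : List T} {a : T} :
    w ∈ symbolYield L (.terminal a) ↔ w = [a] := Iff.rfl

lemma stringYield_mono (h : ∀ B, L B ≤ L' B) (s : List (Symbol T N)) :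
    stringYield L s ≤ stringYield L' s := by
  induction s with
  | nil => exact le_rfl
  | cons x s ih =>
    intro w hw
    obtain ⟨u, hu, v, hv, rfl⟩ := mem_stringYield_cons.1 hw
    refine mem_stringYield_cons.2 ⟨u, ?_, v, ih hv, rfl⟩
    cases x with
    | terminal a => exact hu
    | nonterminal B => exact h B hu

lemma mem_stringYield_map_terminal {w : List T} :
    w ∈ stringYield L (w.map .terminal) := by
  induction w with
  | nil => exact mem_stringYield_nil.2 rfl
  | cons a w ih => exact mem_stringYield_cons.2 ⟨[a], rfl, w, ih, rfl⟩

lemma length_le_of_mem_stringYield {M : ℕ} (hM : ∀ B, ∀ w ∈ L B, w.length ≤ M)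
    {s : List (Symbol T N)} {w : List T} (hw : w ∈ stringYield L s) :
    w.length ≤ s.length * (M + 1) := by
  induction s generalizing w with
  | nil => simp [mem_stringYield_nil.1 hw]
  | cons x s ih =>
    obtain ⟨u, hu, v, hv, rfl⟩ := mem_stringYield_cons.1 hw
    have hu' : u.length ≤ M + 1 := by
      cases x with
      | terminal a => simp [mem_symbolYield_terminal.1 hu]
      | nonterminal B => exact (hM B u hu).trans (Nat.le_succ M)
    have := ih hv
    rw [List.length_append, List.length_cons, add_mul]
    omega

/-- If some occurrences of nonterminals are expanded to words in `L` and the resulting word is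
not obtained from `L'`, then one of these occurrences is expanded to a word outside `L'`. -/
lemma exists_mem_notMem_of_stringYield {s : List (Symbol T N)} {w : List T}
    (hw : w ∈ stringYield L s) (hw' : w ∉ stringYield L' s) :
    ∃ p B q u x v, s = p ++ .nonterminal B :: q ∧ w = u ++ x ++ v ∧ u ∈ stringYield L p ∧
      v ∈ stringYield L q ∧ x ∈ L B ∧ x ∉ L' B := by
  induction s generalizing w with
  | nil => exact absurd hw hw'
  | cons y s ih =>
    obtain ⟨u, hu, v, hv, rfl⟩ := mem_stringYield_cons.1 hw
    by_cases hu' : u ∈ symbolYield L' y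
    · have hv' : v ∉ stringYield L' s := fun h => hw' (mem_stringYield_cons.2 ⟨u, hu', v, h, rfl⟩)
      obtain ⟨p, B, q, u', x, v', rfl, rfl, h1, h2⟩ := ih hv hv'
      exact ⟨y :: p, B, q, u ++ u', x, v', rfl, by simp,
        mem_stringYield_cons.2 ⟨u, hu, u', h1, rfl⟩, h2⟩
    · cases y with
      | terminal a => exact absurd hu hu'
      | nonterminal B =>
        exact ⟨[], B, s, [], u, v, rfl, rfl, mem_stringYield_nil.2 rfl, hv, hu, hu'⟩

end StringYield

variable {g : ContextFreeGrammar T}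

lemma yield_mono : Monotone g.yield := by
  refine monotone_nat_of_le_succ fun h => ?_
  induction h with
  | zero => exact fun A w hw => absurd hw (Set.notMem_empty w)
  | succ h ih =>
    rintro A w ⟨r, hr, hA, hw⟩
    exact ⟨r, hr, hA, stringYield_mono ih _ hw⟩

lemma derives_of_mem_stringYield {L : g.NT → Language T}
    (hL : ∀ A, ∀ w ∈ L A, g.Derives [.nonterminal A] (w.map .terminal))
    {s : List (Symbol T g.NT)} {w : List T} (hw : w ∈ stringYield L s) :
    g.Derives s (w.map .terminal) := by
  induction s generalizing w with
  | nil => rw [mem_stringYield_nil.1 hw]; exact Derives.refl _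
  | cons x s ih =>
    obtain ⟨u, hu, v, hv, rfl⟩ := mem_stringYield_cons.1 hw
    have hx : g.Derives [x] (u.map .terminal) := by
      cases x with
      | terminal a => rw [mem_symbolYield_terminal.1 hu]; exact Derives.refl _
      | nonterminal B => exact hL B u hu
    rw [List.map_append]
    exact (hx.append_right s).trans ((ih hv).append_left _)

lemma derives_of_mem_yield {h : ℕ} {A : g.NT} {w : List T} (hw : w ∈ g.yield h A) :
    g.Derives [.nonterminal A] (w.map .terminal) := by
  induction h generalizing A w with
  | zero => exact absurd hw (Set.notMem_empty w)
  | succ h ih =>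
    obtain ⟨r, hr, rfl, hw⟩ := hw
    exact Produces.trans_derives ⟨r, hr, ContextFreeRule.Rewrites.input_output⟩ (derives_of_mem_stringYield (fun A w => ih) hw)

lemma exists_mem_stringYield_of_derives {s : List (Symbol T g.NT)} {w : List T}
    (h : g.Derives s (w.map .terminal)) : ∃ k, w ∈ stringYield (g.yield k) s := by
  induction h using Relation.ReflTransGen.head_induction_on with
  | refl => exact ⟨0, mem_stringYield_map_terminal⟩
  | head hst _ ih =>
    obtain ⟨k, hk⟩ := ih
    obtain ⟨r, hr, hrw⟩ := hst
    obtain ⟨p, q, rfl, rfl⟩ := hrw.exists_parts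
    obtain ⟨_, h', z, hz, rfl⟩ := mem_stringYield_append.1 hk
    obtain ⟨x, hx, y, hy, rfl⟩ := mem_stringYield_append.1 h'
    have hmono := yield_mono (g := g) (Nat.le_succ k)
    refine ⟨k + 1, mem_stringYield_append.2 ⟨x ++ y, mem_stringYield_append.2
      ⟨x, stringYield_mono hmono _ hx, y, ?_, rfl⟩, z, stringYield_mono hmono _ hz, rfl⟩⟩
    exact mem_stringYield_cons.2 ⟨y, ⟨r, hr, rfl, hy⟩, [], mem_stringYield_nil.2 rfl, by simp⟩

lemma mem_language_iff_exists_yield {w : List T} :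
    w ∈ g.language ↔ ∃ h, w ∈ g.yield h g.initial := by
  refine ⟨fun hw => ?_, fun ⟨h, hw⟩ => derives_of_mem_yield hw⟩
  obtain ⟨h, hh⟩ := exists_mem_stringYield_of_derives hw
  obtain ⟨x, hx, y, hy, rfl⟩ := mem_stringYield_cons.1 hh
  rw [mem_stringYield_nil.1 hy, List.append_nil]
  exact ⟨h, hx⟩

lemma exists_length_le_of_mem_yield (g : ContextFreeGrammar T) (h : ℕ) :
    ∃ M, ∀ A, ∀ w ∈ g.yield h A, w.length ≤ M := by
  induction h with
  | zero => exact ⟨0, fun A w hw => absurd hw (Set.notMem_empty w)⟩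
  | succ h ih =>
    obtain ⟨M, hM⟩ := ih
    refine ⟨(g.rules.sup fun r => r.output.length) * (M + 1), ?_⟩
    rintro A w ⟨r, hr, -, hw⟩
    exact (length_le_of_mem_stringYield hM hw).trans
      (Nat.mul_le_mul_right _ (Finset.le_sup (f := fun r => r.output.length) hr))

/-- `g.DerivesContext A B u v`: the nonterminal `A` derives the nonterminal `B` with the word `u`
of terminals to its left and the word `v` to its right. -/
def DerivesContext (g : ContextFreeGrammar T) (A B : g.NT) (u v : List T) : Prop :=
  g.Derives [.nonterminal A] (u.map .terminal ++ ([.nonterminal B] ++ v.map .terminal))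

lemma DerivesContext.derives {A B : g.NT} {u v w : List T} (h : g.DerivesContext A B u v)
    (hw : g.Derives [.nonterminal B] (w.map .terminal)) :
    g.Derives [.nonterminal A] ((u ++ w ++ v).map .terminal) := by
  refine Derives.trans h ?_
  simpa using (hw.append_right (v.map .terminal)).append_left (u.map .terminal)

lemma DerivesContext.refl (A : g.NT) : g.DerivesContext A A [] [] := Relation.ReflTransGen.refl

lemma DerivesContext.trans {A B C : g.NT} {u v u' v' : List T} (h : g.DerivesContext A B u v)
    (h' : g.DerivesContext B C u' v') : g.DerivesContext A C (u ++ u') (v' ++ v) := by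
  refine Derives.trans h ?_
  have := (Derives.append_right h' (v.map .terminal)).append_left (u.map .terminal)
  simpa [DerivesContext] using this

lemma DerivesContext.iterate {A : g.NT} {u v : List T} (h : g.DerivesContext A A u v) (i : ℕ) :
    g.DerivesContext A A (List.replicate i u).flatten (List.replicate i v).flatten := by
  induction i with
  | zero => exact .refl A
  | succ i ih =>
    rw [List.replicate_succ, List.replicate_succ' (a := v), List.flatten_cons,
      List.flatten_append, List.flatten_singleton]
    exact h.trans ih

/-- A parse tree of least height `h + 2` for its word has below its root a tree of least height
`h + 1` for its word. -/
lemma exists_derivesContext_of_mem_yield {h : ℕ} {A : g.NT} {w : List T}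
    (hw : w ∈ g.yield (h + 2) A) (hw' : w ∉ g.yield (h + 1) A) :
    ∃ B x u v, w = u ++ x ++ v ∧ g.DerivesContext A B u v ∧ x ∈ g.yield (h + 1) B ∧
      x ∉ g.yield h B := by
  obtain ⟨r, hr, rfl, hwr⟩ := hw
  have hwr' : w ∉ stringYield (g.yield h) r.output := fun h => hw' ⟨r, hr, rfl, h⟩
  obtain ⟨p, B, q, u, x, v, hout, rfl, hu, hv, hx, hx'⟩ := exists_mem_notMem_of_stringYield hwr hwr'
  refine ⟨B, x, u, v, rfl, ?_, hx, hx'⟩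
  have hd := fun A w => derives_of_mem_yield (g := g) (h := h + 1) (A := A) (w := w)
  refine Produces.trans_derives ⟨r, hr, ContextFreeRule.Rewrites.input_output⟩ ?_
  rw [hout]
  have h1 := (derives_of_mem_stringYield hd hu).append_right (.nonterminal B :: q)
  have h2 := ((derives_of_mem_stringYield hd hv).append_left [.nonterminal B]).append_left
    (u.map .terminal)
  exact h1.trans h2

/-- A parse tree of least height `k + 1` for its word contains, along one path, subtrees `f i` of
least height `i + 1` for their words, for all `i ≤ k`. -/
lemma exists_path_of_mem_yield {k : ℕ} {A : g.NT} {w : List T} (hw : w ∈ g.yield (k + 1) A)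
    (hw' : w ∉ g.yield k A) :
    ∃ f : ℕ → g.NT × List T, f k = (A, w) ∧
      (∀ i ≤ k, (f i).2 ∈ g.yield (i + 1) (f i).1 ∧ (f i).2 ∉ g.yield i (f i).1) ∧
      ∀ i j, i ≤ j → j ≤ k → ∃ u v, (f j).2 = u ++ (f i).2 ++ v ∧
        g.DerivesContext (f j).1 (f i).1 u v := by
  induction k generalizing A w with
  | zero =>
    refine ⟨fun _ => (A, w), rfl, ?_, ?_⟩
    · intro i hi
      obtain rfl : i = 0 := by omega
      exact ⟨hw, hw'⟩
    · intro i j _ _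
      exact ⟨[], [], by simp, .refl A⟩
  | succ k ih =>
    obtain ⟨B, x, u, v, rfl, hctx, hx, hx'⟩ := exists_derivesContext_of_mem_yield hw hw'
    obtain ⟨f, hf, h1, h2⟩ := ih hx hx'
    refine ⟨Function.update f (k + 1) (A, u ++ x ++ v), by simp, ?_, ?_⟩
    · intro i hi
      rcases Nat.le_succ_iff.1 hi with hi | rfl
      · rw [Function.update_of_ne (by omega)]
        exact h1 i hi
      · simpa using ⟨by simpa using hw, by simpa using hw'⟩
    · intro i j hij hj
      rcases Nat.le_succ_iff.1 hj with hj | rfl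
      · rw [Function.update_of_ne (by omega), Function.update_of_ne (by omega)]
        exact h2 i j hij hj
      · rcases Nat.le_succ_iff.1 hij with hi | rfl
        · obtain ⟨u', v', h3, h4⟩ := h2 i k hi le_rfl
          rw [hf] at h3 h4
          rw [Function.update_self, Function.update_of_ne (by omega)]
          refine ⟨u ++ u', v' ++ v, ?_, hctx.trans h4⟩
          simp only at h3
          simp [h3]
        · exact ⟨[], [], by simp, .refl _⟩

end ContextFreeGrammar

/-- The pumping lemma for context-free languages. On a path through a parse tree of least height,
two of the lowest subtrees have the same root; they stand for different words, since their least
heights differ. -/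
theorem Language.IsContextFree.pumping {T : Type*} {L : Language T} (hL : L.IsContextFree) :
    ∃ N, ∀ w ∈ L, N ≤ w.length → ∃ u v x y z, w = u ++ (v ++ x ++ y) ++ z ∧
      (v ++ x ++ y).length ≤ N ∧ v ++ y ≠ [] ∧
      ∀ i, u ++ ((List.replicate i v).flatten ++ x ++ (List.replicate i y).flatten) ++ z ∈ L := by
  classical
  obtain ⟨g, rfl⟩ := hL
  set I := g.rules.image ContextFreeRule.input with hI
  obtain ⟨M, hM⟩ := g.exists_length_le_of_mem_yield (I.card + 1)
  refine ⟨M + 1, fun w hw hlen => ?_⟩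
  have hex := ContextFreeGrammar.mem_language_iff_exists_yield.1 hw
  obtain ⟨k, hk⟩ : ∃ k, Nat.find hex = k + 1 := by
    refine Nat.exists_eq_succ_of_ne_zero fun h => ?_
    have := Nat.find_spec hex
    rw [h] at this
    exact Set.notMem_empty w this
  have hwk : w ∈ g.yield (k + 1) g.initial := hk ▸ Nat.find_spec hex
  have hwk' : w ∉ g.yield k g.initial := Nat.find_min hex (by omega)
  -- Long words only have tall parse trees.
  have hIk : I.card ≤ k := by
    by_contra hlt
    have := hM _ w (ContextFreeGrammar.yield_mono (by omega : k + 1 ≤ I.card + 1) _ hwk)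
    omega
  obtain ⟨f, hf, hmem, hctx⟩ := ContextFreeGrammar.exists_path_of_mem_yield hwk hwk'
  obtain ⟨i, j, hij, hj, hfij⟩ : ∃ i j, i < j ∧ j ≤ I.card ∧ (f i).1 = (f j).1 := by
    have hmaps : ∀ i ∈ Finset.range (I.card + 1), (f i).1 ∈ I := by
      intro i hi
      obtain ⟨r, hr, hri, -⟩ := (hmem i (by have := Finset.mem_range.1 hi; omega)).1
      exact Finset.mem_image.2 ⟨r, hr, hri⟩
    obtain ⟨i, hi, j, hj, hne, h⟩ :=
      Finset.exists_ne_map_eq_of_card_lt_of_maps_to (by simp) hmaps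
    rw [Finset.mem_range] at hi hj
    rcases hne.lt_or_gt with h' | h'
    · exact ⟨i, j, h', by omega, h⟩
    · exact ⟨j, i, h', by omega, h.symm⟩
  obtain ⟨v, y, hvy, hB⟩ := hctx i j hij.le (by omega)
  obtain ⟨u, z, huz, hS⟩ := hctx j k (by omega) le_rfl
  rw [hf] at huz hS
  refine ⟨u, v, (f i).2, y, z, ?_, ?_, ?_, ?_⟩
  · rw [← hvy]
    exact huz
  · rw [← hvy]
    exact (hM _ _ (ContextFreeGrammar.yield_mono (by omega : j + 1 ≤ I.card + 1) _
      (hmem j (by omega)).1)).trans (Nat.le_succ M)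
  · intro h
    obtain ⟨rfl, rfl⟩ := List.append_eq_nil_iff.1 h
    refine (hmem j (by omega)).2 ?_
    have := ContextFreeGrammar.yield_mono (by omega : i + 1 ≤ j) _ (hmem i (by omega)).1
    rw [hvy, ← hfij, List.nil_append, List.append_nil]
    exact this
  · intro m
    rw [hfij] at hB
    have hx := ContextFreeGrammar.derives_of_mem_yield (hmem i (by omega)).1
    rw [hfij] at hx
    exact hS.derives ((hB.iterate m).derives hx)

/-! ### Even palindromes -/

/-- The language of the palindromes of even length. -/
def evenPalindromes (T : Type*) : Language T :=
  {w | ∃ x : List T, w = x ++ x.reverse}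

theorem isContextFree_evenPalindromes (T : Type*) [Finite T] :
    (evenPalindromes T).IsContextFree := by
  classical
  have := Fintype.ofFinite T
  let ρ : T → ContextFreeRule T Unit :=
    fun a => ⟨(), [.terminal a, .nonterminal (), .terminal a]⟩
  let g : ContextFreeGrammar T := ⟨Unit, (), insert ⟨(), []⟩ (Finset.univ.image ρ)⟩
  have hg : ∀ r, r ∈ g.rules ↔ r = ⟨(), []⟩ ∨ ∃ a, ρ a = r := by simp [g]
  refine ⟨g, Set.ext fun w => ContextFreeGrammar.mem_language_iff_exists_yield.trans ⟨?_, ?_⟩⟩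
  · rintro ⟨h, hw⟩
    induction h generalizing w with
    | zero => exact absurd hw (Set.notMem_empty w)
    | succ h ih =>
      obtain ⟨r, hr, -, hw⟩ := hw
      rcases (hg r).1 hr with rfl | ⟨a, rfl⟩
      · exact ⟨[], by simpa using ContextFreeGrammar.mem_stringYield_nil.1 hw⟩
      · simp only [ρ, ContextFreeGrammar.mem_stringYield_cons,
          ContextFreeGrammar.mem_stringYield_nil, ContextFreeGrammar.mem_symbolYield_terminal] at hw
        obtain ⟨_, rfl, _, ⟨u, hu, _, ⟨_, rfl, _, rfl, rfl⟩, rfl⟩, rfl⟩ := hw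
        obtain ⟨x, rfl⟩ := ih u hu
        exact ⟨a :: x, by simp⟩
  · rintro ⟨x, rfl⟩
    refine ⟨x.length + 1, ?_⟩
    induction x with
    | nil => exact ⟨_, (hg _).2 (Or.inl rfl), rfl, ContextFreeGrammar.mem_stringYield_nil.2 rfl⟩
    | cons a x ih =>
      refine ⟨ρ a, (hg _).2 (Or.inr ⟨a, rfl⟩), rfl, ?_⟩
      simp only [ρ, ContextFreeGrammar.mem_stringYield_cons,
        ContextFreeGrammar.mem_stringYield_nil, ContextFreeGrammar.mem_symbolYield_terminal]
      exact ⟨[a], rfl, _, ⟨x ++ x.reverse, ih, [a], ⟨[a], rfl, [], rfl, rfl⟩, rfl⟩, by simp⟩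

/-! ### The words `0^(a₁) 1 … 0^(aₖ) 1` -/

lemma unaryBlocks_succ {k : ℕ} (a : Fin (k + 1) → ℕ) :
    unaryBlocks a = List.replicate (a 0) 0 ++ 1 :: unaryBlocks fun i => a i.succ := by
  simp [unaryBlocks, List.ofFn_succ]

lemma length_unaryBlocks {k : ℕ} (a : Fin k → ℕ) : (unaryBlocks a).length = ∑ i, (a i + 1) := by
  induction k with
  | zero => simp [unaryBlocks]
  | succ k ih => simp [unaryBlocks_succ, ih, Fin.sum_univ_succ]; omega

/-- The words `unaryBlocks a`, for tuples `a` of a fixed length, form a prefix code. -/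
lemma unaryBlocks_append_inj {k : ℕ} {a b : Fin k → ℕ} {u v : List (Fin 2)}
    (h : unaryBlocks a ++ u = unaryBlocks b ++ v) : a = b ∧ u = v := by
  have key : ∀ (m n : ℕ) (s t : List (Fin 2)),
      List.replicate m 0 ++ 1 :: s = List.replicate n 0 ++ 1 :: t → m = n ∧ s = t := by
    intro m
    induction m with
    | zero =>
      rintro (_ | n) s t h
      · simpa using h
      · simp [List.replicate_succ] at h
    | succ m ih =>
      rintro (_ | n) s t h
      · simp [List.replicate_succ] at h
      · simpa using ih n s t (by simpa [List.replicate_succ] using h)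
  induction k with
  | zero => exact ⟨Subsingleton.elim _ _, by simpa [unaryBlocks] using h⟩
  | succ k ih =>
    simp only [unaryBlocks_succ, List.append_assoc, List.cons_append] at h
    obtain ⟨h0, h1⟩ := key _ _ _ _ h
    obtain ⟨h2, h3⟩ := ih h1
    exact ⟨funext (Fin.cases h0 (congrFun h2)), h3⟩

lemma unaryBlocks_injective (k : ℕ) : Function.Injective (unaryBlocks (k := k)) := fun _ _ h =>
  (unaryBlocks_append_inj (u := []) (v := []) (by rw [h])).1

lemma unaryBlocks_append_mem_repeatedBlocksLanguage {k : ℕ} {a b : Fin k → ℕ}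
    (h : unaryBlocks a ++ unaryBlocks b ∈ repeatedBlocksLanguage k) : a = b := by
  obtain ⟨c, hc⟩ := h
  obtain ⟨rfl, h'⟩ := unaryBlocks_append_inj hc
  exact (unaryBlocks_injective k h').symm

lemma unaryBlocks_append_mem_evenPalindromes {k : ℕ} {a b : Fin k → ℕ}
    (h : unaryBlocks a ++ (unaryBlocks b).reverse ∈ evenPalindromes (Fin 2)) : a = b := by
  obtain ⟨x, hx⟩ := h
  have hrev := congrArg List.reverse hx
  rw [List.reverse_append, List.reverse_reverse, List.reverse_append, List.reverse_reverse, ← hx]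
    at hrev
  exact (unaryBlocks_append_inj hrev).1.symm

/-! ### The Heisenberg group -/

/-- The unitriangular matrix with entries `a`, `b` above the diagonal and `c` in the corner. -/
def heis (a b c : ℤ) : heisenbergGroup :=
  ⟨⟨!![1, a, c; 0, 1, b; 0, 0, 1], by simp [Matrix.det_fin_three]⟩, by
    refine ⟨fun i => ?_, fun i j h => ?_⟩
    · fin_cases i <;> rfl
    · fin_cases i <;> fin_cases j <;> first | exact absurd h (by decide) | rfl⟩

lemma heis_mul (a b c a' b' c' : ℤ) :
    heis a b c * heis a' b' c' = heis (a + a') (b + b') (c + c' + a * b') := by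
  refine Subtype.ext (Subtype.ext ?_)
  ext i j
  change (!![1, a, c; 0, 1, b; 0, 0, 1] * !![1, a', c'; 0, 1, b'; 0, 0, 1]) i j =
    !![1, a + a', c + c' + a * b'; 0, 1, b + b'; 0, 0, 1] i j
  fin_cases i <;> fin_cases j <;> simp [Matrix.mul_apply, Fin.sum_univ_three] <;> ring

lemma one_eq_heis : (1 : heisenbergGroup) = heis 0 0 0 := by
  refine Subtype.ext (Subtype.ext ?_)
  ext i j
  change (1 : Matrix (Fin 3) (Fin 3) ℤ) i j = !![1, 0, 0; 0, 1, 0; 0, 0, 1] i j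
  fin_cases i <;> fin_cases j <;> simp

lemma heis_inj {a b c a' b' c' : ℤ} : heis a b c = heis a' b' c' ↔ a = a' ∧ b = b' ∧ c = c' := by
  refine ⟨fun h => ?_, by rintro ⟨rfl, rfl, rfl⟩; rfl⟩
  have h' : !![1, a, c; 0, 1, b; 0, 0, 1] = !![1, a', c'; 0, 1, b'; 0, 0, 1] :=
    congrArg (fun g : heisenbergGroup => g.1.1) h
  exact ⟨congrFun (congrFun h' 0) 1, congrFun (congrFun h' 1) 2, congrFun (congrFun h' 0) 2⟩

lemma exists_eq_heis (g : heisenbergGroup) : ∃ a b c, g = heis a b c := by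
  obtain ⟨g, h1, h2⟩ := g
  refine ⟨g.1 0 1, g.1 1 2, g.1 0 2, Subtype.ext (Subtype.ext ?_)⟩
  ext i j
  change g.1 i j = !![1, g.1 0 1, g.1 0 2; 0, 1, g.1 1 2; 0, 0, 1] i j
  have h3 := h2 1 0 (by decide)
  have h4 := h2 2 0 (by decide)
  have h5 := h2 2 1 (by decide)
  fin_cases i <;> fin_cases j <;> simp [h1, h3, h4, h5]

lemma heis_pow_left (a c : ℤ) (n : ℕ) : heis a 0 c ^ n = heis (n * a) 0 (n * c) := by
  induction n with
  | zero => simp [one_eq_heis]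
  | succ n ih =>
    rw [pow_succ, ih, heis_mul, heis_inj, Nat.cast_succ]
    exact ⟨by ring, by ring, by ring⟩

lemma heis_pow_right (b c : ℤ) (n : ℕ) : heis 0 b c ^ n = heis 0 (n * b) (n * c) := by
  induction n with
  | zero => simp [one_eq_heis]
  | succ n ih =>
    rw [pow_succ, ih, heis_mul, heis_inj, Nat.cast_succ]
    exact ⟨by ring, by ring, by ring⟩

/-- The elements of the Heisenberg group whose entries are at most `R` above the diagonal and at
most `R ^ 2` in the corner, in absolute value. -/
noncomputable def heisBox (R : ℕ) : Finset heisenbergGroup := by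
  classical
  exact (Finset.Icc (-R : ℤ) R ×ˢ Finset.Icc (-R : ℤ) R ×ˢ
    Finset.Icc (-(R ^ 2 : ℕ) : ℤ) (R ^ 2 : ℕ)).image fun p => heis p.1 p.2.1 p.2.2

lemma mem_heisBox {R : ℕ} {a b c : ℤ} :
    heis a b c ∈ heisBox R ↔ |a| ≤ R ∧ |b| ≤ R ∧ |c| ≤ (R : ℤ) ^ 2 := by
  simp [heisBox, heis_inj, abs_le, and_assoc]

lemma card_heisBox_le (R : ℕ) : (heisBox R).card ≤ (2 * R + 1) ^ 2 * (2 * R ^ 2 + 1) := by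
  refine Finset.card_image_le.trans_eq ?_
  simp only [Finset.card_product, Int.card_Icc]
  rw [show ((R : ℤ) + 1 - -(R : ℤ)).toNat = 2 * R + 1 by omega,
    show (((R ^ 2 : ℕ) : ℤ) + 1 - -((R ^ 2 : ℕ) : ℤ)).toNat = 2 * R ^ 2 + 1 by omega]
  ring

lemma heisBox_mono {R S : ℕ} (h : R ≤ S) : heisBox R ⊆ heisBox S := by
  intro g hg
  obtain ⟨a, b, c, rfl⟩ := exists_eq_heis g
  rw [mem_heisBox] at hg ⊢
  have h' : (R : ℤ) ≤ S := by exact_mod_cast h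
  exact ⟨hg.1.trans h', hg.2.1.trans h', hg.2.2.trans (by gcongr)⟩

lemma exists_subset_heisBox {s : Set heisenbergGroup} (hs : s.Finite) :
    ∃ R, 1 ≤ R ∧ s ⊆ heisBox R := by
  induction s, hs using Set.Finite.induction_on with
  | empty => exact ⟨1, le_rfl, Set.empty_subset _⟩
  | @insert g s _ _ ih =>
    obtain ⟨R, hR, hsR⟩ := ih
    obtain ⟨a, b, c, rfl⟩ := exists_eq_heis g
    refine ⟨R + a.natAbs + b.natAbs + c.natAbs, by omega, Set.insert_subset ?_
      (hsR.trans (heisBox_mono (by omega)))⟩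
    have ha := abs_nonneg a
    have hb := abs_nonneg b
    have hc := abs_nonneg c
    have hR' : (1 : ℤ) ≤ R := by exact_mod_cast hR
    refine mem_heisBox.2 ⟨?_, ?_, ?_⟩ <;> push_cast
    · linarith
    · linarith
    · nlinarith

/-- A product of `s` factors from a box of size `R` lies in a box of size `R * s`: the corner entry
grows quadratically. -/
lemma prod_mem_heisBox {R : ℕ} (hR : 1 ≤ R) {l : List heisenbergGroup}
    (hl : ∀ g ∈ l, g ∈ heisBox R) : l.prod ∈ heisBox (R * l.length) := by
  induction l with
  | nil => simp [one_eq_heis, mem_heisBox]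
  | cons g l ih =>
    have h1 := hl g (by simp)
    have h2 := ih fun x hx => hl x (by simp [hx])
    rw [List.prod_cons, List.length_cons]
    obtain ⟨a, b, c, rfl⟩ := exists_eq_heis g
    obtain ⟨a', b', c', h⟩ := exists_eq_heis l.prod
    rw [h] at h2 ⊢
    rw [heis_mul, mem_heisBox]
    rw [mem_heisBox] at h1 h2
    obtain ⟨ha, hb, hc⟩ := h1
    obtain ⟨ha', hb', hc'⟩ := h2
    push_cast at ha' hb' hc' ⊢
    have hab : |a * b'| ≤ R * (R * l.length) := by
      rw [abs_mul]
      gcongr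
    refine ⟨(abs_add_le _ _).trans (by linarith), (abs_add_le _ _).trans (by linarith), ?_⟩
    have h3 : |c + c' + a * b'| ≤ |c| + |c'| + |a * b'| := abs_add_three _ _ _
    nlinarith [mul_nonneg (sq_nonneg (R : ℤ)) (Int.natCast_nonneg l.length)]

lemma exists_forall_le_mul_of_isBigO {t : ℕ → ℕ}
    (ht : (fun n => (t n : ℝ)) =O[atTop] (fun n => (n : ℝ))) :
    ∃ C, ∀ n, 1 ≤ n → ∀ m ≤ n, t m ≤ C * n := by
  obtain ⟨c, hc⟩ := ht.bound
  obtain ⟨N, hN⟩ := eventually_atTop.1 hc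
  -- The finitely many values for which the bound with constant `c` may fail are added to it.
  refine ⟨⌈c⌉₊ + ∑ m ∈ Finset.range N, t m, fun n hn m hm => ?_⟩
  rcases lt_or_ge m N with h | h
  · have h1 : t m ≤ ∑ m ∈ Finset.range N, t m :=
      Finset.single_le_sum (f := t) (fun _ _ => Nat.zero_le _) (Finset.mem_range.2 h)
    nlinarith
  · have h1 : (t m : ℝ) ≤ c * m := by simpa using hN m h
    have h2 : (t m : ℝ) ≤ (⌈c⌉₊ : ℝ) * m :=
      h1.trans (mul_le_mul_of_nonneg_right (Nat.le_ceil c) (Nat.cast_nonneg m))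
    have h3 : t m ≤ ⌈c⌉₊ * m := by exact_mod_cast h2
    exact h3.trans (Nat.mul_le_mul (Nat.le_add_right _ _) hm)

/-- In linear time, an automaton over the Heisenberg group tells apart only `O(n ^ 4)` prefixes of
words of length at most `n`, as the group has growth of degree `4`. -/
theorem exists_card_fooling_le {α : Type} [Finite α] {L : Language α}
    (hL : L ∈ LanguageClass.weakLinearTime heisenbergGroup α) :
    ∃ K, ∀ n, 1 ≤ n → ∀ {ι : Type} (I : Finset ι) (u v : ι → List α),
      (∀ i ∈ I, u i ++ v i ∈ L ∧ (u i ++ v i).length ≤ n) →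
      (∀ i ∈ I, ∀ j ∈ I, u i ++ v j ∈ L → i = j) → I.card ≤ K * n ^ 4 := by
  obtain ⟨t, ht, A, rfl, hA⟩ := hL
  obtain ⟨C, hC⟩ := exists_forall_le_mul_of_isBigO ht
  obtain ⟨R, hR, hAR⟩ := exists_subset_heisBox
    (A.finite_transitions.image GroupAutomaton.Transition.weight)
  refine ⟨Nat.card A.State * ((2 * (R * C) + 1) ^ 2 * (2 * (R * C) ^ 2 + 1)),
    fun n hn ι I u v h1 h2 => ?_⟩
  have h3 : I.card ≤ Nat.card A.State * (heisBox (R * (C * n))).card := by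
    refine A.card_le_of_fooling I u v (C * n) (fun i hi => ?_) h2 _ fun r hr hlen => ?_
    · obtain ⟨s, hs, h⟩ := hA _ (h1 i hi).1
      exact ⟨s, hs.trans (hC n hn _ (h1 i hi).2), h⟩
    · have := prod_mem_heisBox hR (l := r.map GroupAutomaton.Transition.weight) (by
        simp only [List.mem_map]
        rintro _ ⟨t, htr, rfl⟩
        exact hAR ⟨t, hr t htr, rfl⟩)
      rw [List.length_map] at this
      exact heisBox_mono (Nat.mul_le_mul_left R hlen) this
  have h4 : 2 * (R * (C * n)) + 1 ≤ (2 * (R * C) + 1) * n := by nlinarith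
  have h5 : 2 * (R * (C * n)) ^ 2 + 1 ≤ (2 * (R * C) ^ 2 + 1) * n ^ 2 := by
    have : 1 ≤ n ^ 2 := Nat.one_le_pow _ _ hn
    nlinarith
  calc I.card ≤ Nat.card A.State * ((2 * (R * (C * n)) + 1) ^ 2 * (2 * (R * (C * n)) ^ 2 + 1)) :=
        h3.trans (Nat.mul_le_mul_left _ (card_heisBox_le _))
    _ ≤ Nat.card A.State * (((2 * (R * C) + 1) * n) ^ 2 * ((2 * (R * C) ^ 2 + 1) * n ^ 2)) := by
        gcongr
    _ = _ := by ring

/-- There are `n ^ 5` words `unaryBlocks a` with entries of `a : Fin 5 → ℕ` below `n`, too many for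
a language that tells them apart to be recognized in linear time. -/
theorem notMem_weakLinearTime_heisenbergGroup {L : Language (Fin 2)}
    (v : (Fin 5 → ℕ) → List (Fin 2)) (hlen : ∀ a, (v a).length = (unaryBlocks a).length)
    (hmem : ∀ a, unaryBlocks a ++ v a ∈ L) (hinj : ∀ a b, unaryBlocks a ++ v b ∈ L → a = b) :
    L ∉ LanguageClass.weakLinearTime heisenbergGroup (Fin 2) := by
  intro hL
  obtain ⟨K, hK⟩ := exists_card_fooling_le hL
  -- The words have length at most `10 * n`, and `n ^ 5 > K * (10 * n) ^ 4` for this `n`.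
  obtain ⟨n, hn⟩ : ∃ n, n = K * 10 ^ 4 + 1 := ⟨_, rfl⟩
  have h := hK (10 * n) (by omega) (Fintype.piFinset fun _ : Fin 5 => Finset.range n)
    unaryBlocks v (fun a ha => ⟨hmem a, ?_⟩) fun a _ b _ => hinj a b
  · rw [Fintype.card_piFinset_const, Finset.card_range] at h
    have h1 : n * n ^ 4 ≤ (K * 10 ^ 4) * n ^ 4 := by
      calc n * n ^ 4 = n ^ 5 := by ring
        _ ≤ K * (10 * n) ^ 4 := h
        _ = _ := by ring
    have := Nat.le_of_mul_le_mul_right h1 (pow_pos (by omega) 4)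
    omega
  · have h1 : ∑ i, (a i + 1) ≤ ∑ _i : Fin 5, n := Finset.sum_le_sum fun i _ => by
      have := Finset.mem_range.1 (Fintype.mem_piFinset.1 ha i)
      omega
    rw [List.length_append, hlen, length_unaryBlocks]
    simp only [Finset.sum_const, Finset.card_univ, Fintype.card_fin, smul_eq_mul] at h1
    omega

/-! ### The language of products -/

lemma reduceOption_map_some {α : Type*} (l : List α) : (l.map some).reduceOption = l := by
  simp [List.reduceOption, List.filterMap_map]

lemma reduceOption_replicate_some {α : Type*} (n : ℕ) (a : α) :
    (List.replicate n (some a)).reduceOption = List.replicate n a := by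
  rw [← List.map_replicate, reduceOption_map_some]

lemma count_two_of_mem_multLanguage {w : List (Fin 3)} (hw : w ∈ multLanguage) :
    w.count 2 = w.count 0 * w.count 1 := by
  obtain ⟨p, q, rfl⟩ := hw
  simp [List.count_replicate]

/-- In the Heisenberg group, `x ^ p * y ^ q * z ^ (-r) * x ^ (-s) * y ^ (-t)` is trivial if and only
if `s = p`, `t = q` and `r = p * q`, where `x`, `y` are the generators above the diagonal and
`z` is their commutator. -/
lemma heis_word_eq_one_iff (p q r s t : ℕ) :
    heis 1 0 0 ^ p * (heis 0 1 0 ^ q * (heis 0 0 (-1) ^ r * (heis (-1) 0 0 ^ s *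
      heis 0 (-1) 0 ^ t))) = 1 ↔ s = p ∧ t = q ∧ r = p * q := by
  simp only [heis_pow_left, heis_pow_right, heis_mul, one_eq_heis, heis_inj]
  constructor
  · rintro ⟨h1, h2, h3⟩
    have h1' : (s : ℤ) = p := by linarith
    have h2' : (t : ℤ) = q := by linarith
    refine ⟨by exact_mod_cast h1', by exact_mod_cast h2', ?_⟩
    have : (r : ℤ) = p * q := by
      rw [h1', h2'] at h3
      linarith
    exact_mod_cast this
  · rintro ⟨rfl, rfl, rfl⟩
    push_cast
    exact ⟨by ring, by ring, by ring⟩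

/-- After reading `0 ^ p 1 ^ q 2 ^ r` with multipliers `x`, `y`, `z⁻¹`, the automaton returns to the
neutral element by moves that read nothing, `p` times `x⁻¹` and then `q` times `y⁻¹`. -/
theorem multLanguage_mem_weakLinearTime :
    multLanguage ∈ LanguageClass.weakLinearTime heisenbergGroup (Fin 3) := by
  let a : ℕ → Option (Fin 3) := fun i => [some 0, some 1, some 2].getD i none
  let g : ℕ → heisenbergGroup := fun i =>
    [heis 1 0 0, heis 0 1 0, heis 0 0 (-1), heis (-1) 0 0, heis 0 (-1) 0].getD i 1
  have hacc : ∀ w m, (GroupAutomaton.chain 5 a (fun _ => none) g).AcceptsIn w m ↔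
      ∃ p q : ℕ, w = List.replicate p 0 ++ List.replicate q 1 ++ List.replicate (p * q) 2 ∧
        m = 2 * p + 2 * q + p * q + 5 := by
    intro w m
    have hrange : List.range' 0 5 = [0, 1, 2, 3, 4] := rfl
    rw [GroupAutomaton.chain_acceptsIn_iff]
    have hred : ∀ c, (GroupAutomaton.chainLabels a (fun _ => none) c 0 5).reduceOption =
        List.replicate (c 0) 0 ++ List.replicate (c 1) 1 ++ List.replicate (c 2) 2 := by
      intro c
      simp [GroupAutomaton.chainLabels, hrange, a,
        List.reduceOption_append, reduceOption_replicate_some]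
    have hlen : ∀ c, (GroupAutomaton.chainLabels a (fun _ => none) c 0 5).length =
        c 0 + c 1 + c 2 + c 3 + c 4 + 5 := by
      intro c
      simp [GroupAutomaton.chainLabels, hrange]
      omega
    have hwt : ∀ c, GroupAutomaton.chainWeight g c 0 5 = 1 ↔
        c 3 = c 0 ∧ c 4 = c 1 ∧ c 2 = c 0 * c 1 := by
      intro c
      rw [← heis_word_eq_one_iff]
      simp [GroupAutomaton.chainWeight, hrange, g]
    simp only [hred, hlen, hwt]
    constructor
    · rintro ⟨c, rfl, ⟨h1, h2, h3⟩, rfl⟩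
      exact ⟨c 0, c 1, by rw [h3], by rw [h1, h2, h3]; ring⟩
    · rintro ⟨p, q, rfl, rfl⟩
      exact ⟨fun i => [p, q, p * q, p, q].getD i 0, rfl, ⟨rfl, rfl, rfl⟩, by simp; ring⟩
  refine ⟨fun n => 2 * n + 5, ?_, .chain 5 a (fun _ => none) g, Set.ext fun w => (?_ : (∃ m, _) ↔ _), fun w hw => ?_⟩
  · refine IsBigO.of_bound 7 (eventually_atTop.2 ⟨1, fun n hn => ?_⟩)
    have : (1 : ℝ) ≤ n := by exact_mod_cast hn
    simp only [Real.norm_natCast]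
    push_cast
    linarith
  · simp only [hacc]
    constructor
    · rintro ⟨m, p, q, h, -⟩
      exact ⟨p, q, h⟩
    · rintro ⟨p, q, h⟩
      exact ⟨_, p, q, h, rfl⟩
  · obtain ⟨m, hm⟩ := hw
    refine ⟨m, ?_, hm⟩
    obtain ⟨p, q, rfl, rfl⟩ := (hacc w m).1 hm
    simp
    nlinarith [Nat.zero_le (p * q)]

/-- The words `0 ^ n 1 ^ n 2 ^ (n ^ 2)` contradict pumping: `(n, n ^ 2)` moves on a strictly convex
curve, and so three of these points never form an arithmetic progression. -/
theorem multLanguage_notMem_weakLinearTime (G : Type*) [CommGroup G] :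
    multLanguage ∉ LanguageClass.weakLinearTime G (Fin 3) := by
  rintro ⟨-, -, A, hA, -⟩
  obtain ⟨m, n, hmn, w, hw, hcount⟩ := A.exists_count_add_count_eq
    (fun n => List.replicate n 0 ++ List.replicate n 1 ++ List.replicate (n * n) 2)
    (fun n => hA ▸ ⟨n, n, rfl⟩)
  have h := count_two_of_mem_multLanguage (hA ▸ hw)
  have h0 := hcount 0
  have h1 := hcount 1
  have h2 := hcount 2
  simp [List.count_replicate] at h0 h1 h2
  rw [h] at h2
  -- The count of the letter `2` gives `(2 * n - m) ^ 2 + m ^ 2 = 2 * n ^ 2`, that is, `n = m`.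
  obtain ⟨d, rfl⟩ := Nat.exists_eq_add_of_lt hmn
  have e0 : w.count 0 = m + 2 * (d + 1) := by omega
  have e1 : w.count 1 = m + 2 * (d + 1) := by omega
  rw [e0, e1] at h2
  nlinarith

/-- A pumped factor of `0 ^ n 1 ^ n 2 ^ (n ^ 2)` that adds a letter `0` or `1` would have to add at
least `n` letters `2`, too many for its length. -/
theorem not_isContextFree_multLanguage : ¬ multLanguage.IsContextFree := by
  intro hL
  obtain ⟨N, hN⟩ := hL.pumping
  obtain ⟨n, hn⟩ : ∃ n, n = N + 1 := ⟨_, rfl⟩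
  obtain ⟨u, v, x, y, z, hw, hlen, hne, hpump⟩ := hN
    (List.replicate n 0 ++ List.replicate n 1 ++ List.replicate (n * n) 2) ⟨n, n, rfl⟩
    (by simp; omega)
  have h := count_two_of_mem_multLanguage (hpump 2)
  have hcount : ∀ a : Fin 3, (u ++ ((List.replicate 2 v).flatten ++ x ++
      (List.replicate 2 y).flatten) ++ z).count a =
        (List.replicate n (0 : Fin 3) ++ List.replicate n 1 ++ List.replicate (n * n) 2).count a +
          (v ++ y).count a := by
    intro a
    rw [hw]
    simp [List.replicate_succ]
    omega
  have hl : ∀ l : List (Fin 3), l.length = l.count 0 + l.count 1 + l.count 2 := by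
    intro l
    induction l with
    | nil => rfl
    | cons a l ih => fin_cases a <;> simp [ih] <;> omega
  have hpos := List.length_pos_iff.2 hne
  have hle : (v ++ y).length ≤ N := by
    simp only [List.length_append] at hlen ⊢
    omega
  rw [hl] at hpos hle
  rw [hcount, hcount, hcount] at h
  generalize (v ++ y).count 0 = A, (v ++ y).count 1 = B, (v ++ y).count 2 = C at *
  simp [List.count_replicate] at h
  -- Now `n * n + C = (n + A) * (n + B)`, while `C < n`.
  rcases Nat.eq_zero_or_pos (A + B) with hAB | hAB
  · obtain ⟨rfl, rfl⟩ : A = 0 ∧ B = 0 := by omega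
    simp at h
    omega
  · nlinarith [Nat.zero_le (A * B)]

/-! ### The language of repeated blocks -/

/-- The automaton counts the `i`-th block of letters `0` up in coordinate `i` of the register and
the `(5 + i)`-th block down. -/
theorem repeatedBlocksLanguage_mem_weakLinearTime {k : ℕ} (hk : 5 ≤ k) :
    repeatedBlocksLanguage 5 ∈
      LanguageClass.weakLinearTime (Multiplicative (Fin k → ℤ)) (Fin 2) := by
  let e : ℤ → ℕ → Multiplicative (Fin k → ℤ) :=
    fun s j => Multiplicative.ofAdd fun l => if l.val = j then s else 0
  let g : ℕ → Multiplicative (Fin k → ℤ) := fun i => if i < 5 then e 1 i else e (-1) (i - 5)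
  have hrange : List.range' 0 10 = [0, 1, 2, 3, 4, 5, 6, 7, 8, 9] := rfl
  have hlab : ∀ c : ℕ → ℕ, GroupAutomaton.chainLabels (fun _ => some (0 : Fin 2))
      (fun _ => some 1) c 0 10 = ((unaryBlocks fun i : Fin 5 => c i) ++
        unaryBlocks fun i : Fin 5 => c (5 + i)).map some := by
    intro c
    simp [GroupAutomaton.chainLabels, hrange, unaryBlocks, List.ofFn_succ]
  have hwt : ∀ c, GroupAutomaton.chainWeight g c 0 10 = 1 ↔ ∀ i : Fin 5, c (5 + i) = c i := by
    intro c
    have hval : ∀ l : Fin k, (GroupAutomaton.chainWeight g c 0 10).toAdd l =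
        ∑ i : Fin 5, if l.val = i then (c i : ℤ) - c (5 + i) else 0 := by
      intro l
      simp [GroupAutomaton.chainWeight, hrange, g, e, Fin.sum_univ_succ]
      split_ifs <;> ring
    constructor
    · intro h i
      have := hval ⟨i, by omega⟩
      rw [h] at this
      simp [Fin.val_inj] at this
      omega
    · intro h
      refine Multiplicative.toAdd.injective (funext fun l => ?_)
      rw [hval]
      simp [h]
  have hacc : ∀ w m, (GroupAutomaton.chain 10 (fun _ => some (0 : Fin 2)) (fun _ => some 1)
      g).AcceptsIn w m ↔ (∃ a : Fin 5 → ℕ, w = unaryBlocks a ++ unaryBlocks a) ∧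
        m = w.length := by
    intro w m
    rw [GroupAutomaton.chain_acceptsIn_iff]
    simp only [hlab, hwt, reduceOption_map_some, List.length_map]
    constructor
    · rintro ⟨c, rfl, h, rfl⟩
      exact ⟨⟨fun i => c i, by simp only [h]⟩, rfl⟩
    · rintro ⟨⟨a, rfl⟩, rfl⟩
      refine ⟨fun i => a (Fin.ofNat 5 i), ?_⟩
      have h1 : ∀ i : Fin 5, Fin.ofNat 5 i = i := by decide
      have h2 : ∀ i : Fin 5, Fin.ofNat 5 (5 + i) = i := by decide
      simp only [h1, h2, implies_true, and_self]
  refine ⟨fun n => n, isBigO_refl _ _, .chain 10 (fun _ => some 0) (fun _ => some 1) g,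
    Set.ext fun w => (?_ : (∃ m, _) ↔ _), fun w hw => ?_⟩
  · simp only [hacc]
    exact ⟨fun ⟨m, h, _⟩ => h, fun h => ⟨_, h, rfl⟩⟩
  · obtain ⟨m, hm⟩ := hw
    exact ⟨m, ((hacc w m).1 hm).2.le, hm⟩

theorem repeatedBlocksLanguage_notMem_weakLinearTime :
    repeatedBlocksLanguage 5 ∉ LanguageClass.weakLinearTime heisenbergGroup (Fin 2) :=
  notMem_weakLinearTime_heisenbergGroup unaryBlocks (fun _ => rfl) (fun a => ⟨a, rfl⟩)
    fun _ _ => unaryBlocks_append_mem_repeatedBlocksLanguage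

theorem evenPalindromes_notMem_weakLinearTime :
    evenPalindromes (Fin 2) ∉ LanguageClass.weakLinearTime heisenbergGroup (Fin 2) :=
  notMem_weakLinearTime_heisenbergGroup (fun a => (unaryBlocks a).reverse)
    (fun _ => List.length_reverse) (fun a => ⟨unaryBlocks a, rfl⟩)
    fun _ _ => unaryBlocks_append_mem_evenPalindromes

theorem mainTheorem9 :
    (∀ k : ℕ, 5 ≤ k →
      LanguageClass.Incomparable (LanguageClass.weakLinearTime heisenbergGroup)
          (LanguageClass.weakLinearTime (Multiplicative (Fin k → ℤ))) ∧
        (multLanguage ∈ LanguageClass.weakLinearTime heisenbergGroup (Fin 3) ∧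
          multLanguage ∉ LanguageClass.weakLinearTime (Multiplicative (Fin k → ℤ)) (Fin 3)) ∧
        (repeatedBlocksLanguage 5 ∈ LanguageClass.weakLinearTime (Multiplicative (Fin k → ℤ)) (Fin 2) ∧
          repeatedBlocksLanguage 5 ∉ LanguageClass.weakLinearTime heisenbergGroup (Fin 2))) ∧
    LanguageClass.Incomparable (LanguageClass.weakLinearTime heisenbergGroup) LanguageClass.contextFree := by
  refine ⟨fun k hk => ⟨⟨fun h => ?_, fun h => ?_⟩, ⟨multLanguage_mem_weakLinearTime,
    multLanguage_notMem_weakLinearTime _⟩, repeatedBlocksLanguage_mem_weakLinearTime hk,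
    repeatedBlocksLanguage_notMem_weakLinearTime⟩, fun h => ?_, fun h => ?_⟩
  · exact multLanguage_notMem_weakLinearTime _ (h (Fin 3) multLanguage_mem_weakLinearTime)
  · exact repeatedBlocksLanguage_notMem_weakLinearTime
      (h (Fin 2) (repeatedBlocksLanguage_mem_weakLinearTime hk))
  · exact not_isContextFree_multLanguage (h (Fin 3) multLanguage_mem_weakLinearTime)
  · exact evenPalindromes_notMem_weakLinearTime
      (h (Fin 2) (isContextFree_evenPalindromes (Fin 2)))
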